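/- Let $\mathbb T=\mathbb R/\mathbb Z$ with normalized Haar (Lebesgue) measure $\mathfrak m$, and let $f:\mathbb T\to[0,1]$ be an arbitrary Borel function with $0<\sigma:=\int_{\mathbb T} f\,d\mathfrak m<1$. Put $\widehat f(k)=\int_{\mathbb T} f(t)e^{-2\pi i k t}\,d\mathfrak m(t)$ for $k\in\mathbb Z$. Let $\mathfrak X$ be the determinantal point process on $\mathbb Z$ with kernel $K_f(n,m)=\widehat f(n-m)$, i.e. a random subset of $\mathbb Z$, defined on some probability space, such that for all distinct $n_1,\dots,n_k\in\mathbb Z$ $$\mathbb P(n_1,\dots,n_k\in\mathfrak X)=\det\big(\widehat f(n_i-n_j)\big)_{1\le i,j\le k},$$ and let $\mathfrak X_+=\mathfrak X\cap\mathbb N$, where $\mathbb N=\{0,1,2,\dots\}$. Then, almost surely, the following hold simultaneously. 1. $\mathfrak X_+$ is $L^2$-exact: it is infinite and, if $u_0<u_1<\cdots$ is its increasing enumeration, then for every measure-preserving system $(X,\mathcal B,\nu,T)$ ($\nu$ a probability measure, $T$ not necessarily invertible) and every $g\in L^2(\nu)$, $$\frac1N\sum_{n=0}^{N-1} g(T^{u_n}x)\longrightarrow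 \mathbb E(g\mid\mathcal J_T)\quad\text{in } L^2(\nu)\text{ as } N\to\infty,$$ where $\mathcal J_T$ is the $\sigma$-field of $T$-invariant sets. 2. For every $t\in(0,1)$, the Wiener averages vanish in the limit: $$\lim_{N\to\infty}\frac{1}{\#(\mathfrak X_+\cap[0,N-1])}\sum_{u\in\mathfrak X_+\cap[0,N-1]}e^{2\pi i u t}=0.$$ 3. $\mathfrak X_+$ is a recurrent (Poincaré) set: for every measure-preserving system $(X,\mathcal B,\nu,T)$ with $\nu$ a probability measure and every $A\in\mathcal B$ with $\nu(A)>0$ there is $n\in\mathfrak X_+$ with $n\ge1$ and $\nu(A\cap T^{-n}A)>0$. -/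

import Mathlib

open MeasureTheory Filter Topology

universe u v

noncomputable section

/-- The translation-invariant kernel `K_f (n, m) = f̂ (n - m)` on `ℤ × ℤ`, where
`f̂ (k) = ∫ f(t) e^{-2π i k t} d𝔪(t)` and `𝔪` is the normalized Haar measure of `𝕋 = ℝ / ℤ`. -/
def toeplitzKernel (f : UnitAddCircle → ℝ) (n m : ℤ) : ℂ :=
  fourierCoeff (fun t => (f t : ℂ)) (n - m)

/-- A random subset `𝔛` of `ℤ`, defined on the probability space `(Ω, P)`, is a determinantal point
process with kernel `K`: the indicators `ξ_n` of the events `n ∈ 𝔛` are random variables and, for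
distinct points `n_1, …, n_k`,
`𝔼 (ξ_{n_1} ⋯ ξ_{n_k}) = P (n_1, …, n_k ∈ 𝔛) = det (K (n_i, n_j))_{i, j}`. -/
structure IsDeterminantalProcess {Ω : Type v} [MeasurableSpace Ω] (P : Measure Ω)
    (K : ℤ → ℤ → ℂ) (𝔛 : Ω → Set ℤ) : Prop where
  measurableSet_mem : ∀ n : ℤ, MeasurableSet {ω | n ∈ 𝔛 ω}
  correlation : ∀ (k : ℕ) (n : Fin k → ℤ), Function.Injective n →
    ((P.real {ω | ∀ i, n i ∈ 𝔛 ω} : ℝ) : ℂ) = (Matrix.of fun i j => K (n i) (n j)).det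

/-- The part of a set of integers lying in `ℕ = {0, 1, 2, …}`, as a set of natural numbers. -/
def natPart (S : Set ℤ) : Set ℕ := {n | (n : ℤ) ∈ S}

open scoped Classical in
/-- The Wiener average
`(1 / #(Λ ∩ [0, N - 1])) ∑_{u ∈ Λ ∩ [0, N - 1]} e^{2π i u t}` of a set `Λ` of natural numbers. -/
def wienerAverage (Λ : Set ℕ) (N : ℕ) (t : ℝ) : ℂ :=
  (∑ n ∈ Finset.range N with n ∈ Λ, Complex.exp (2 * Real.pi * Complex.I * n * t)) /
    (Finset.card {n ∈ Finset.range N | n ∈ Λ} : ℂ)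

/-- The ergodic average `(1 / N) ∑_{k < N} g (T^{u_k} x)` along the strictly increasing enumeration
`u_0 < u_1 < …` of an infinite set `Λ` of natural numbers. -/
def averageAlong {X : Type u} (Λ : Set ℕ) (T : X → X) (g : X → ℂ) (N : ℕ) (x : X) : ℂ :=
  (N : ℂ)⁻¹ * ∑ k ∈ Finset.range N, g (T^[Nat.nth (· ∈ Λ) k] x)

/-- A set `Λ` of natural numbers is `L²`-exact if it is infinite and, for every measure-preserving
system `(X, ν, T)` and every `g ∈ L²(ν)`, the averages of `g` along `Λ` converge in `L²(ν)` to the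
conditional expectation of `g` given the `σ`-algebra of `T`-invariant sets. -/
def IsL2Exact (Λ : Set ℕ) : Prop :=
  Λ.Infinite ∧
    ∀ (X : Type u) [MeasurableSpace X] (ν : Measure X) [IsProbabilityMeasure ν] (T : X → X),
      MeasurePreserving T ν ν → ∀ g : X → ℂ, MemLp g 2 ν →
        Tendsto (fun N : ℕ => eLpNorm
          (fun x => averageAlong Λ T g N x - (ν[g | MeasurableSpace.invariants T]) x) 2 ν)
          atTop (𝓝 0)

/-- A set `Λ` of natural numbers is recurrent (a Poincaré set) if, for every measure-preserving
system `(X, ν, T)` and every measurable `A` with `ν(A) > 0`, there is a *positive* `n ∈ Λ` with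
`ν(A ∩ T^{-n} A) > 0`. (The return time `0` does not count: with it the condition is trivial.) -/
def IsRecurrent (Λ : Set ℕ) : Prop :=
  ∀ (X : Type u) [MeasurableSpace X] (ν : Measure X) [IsProbabilityMeasure ν] (T : X → X),
    MeasurePreserving T ν ν → ∀ A : Set X, MeasurableSet A → 0 < ν A →
      ∃ n ∈ Λ, 0 < n ∧ 0 < ν (A ∩ T^[n] ⁻¹' A)

end

/-! All three conclusions follow from one deterministic property of a sample set,
`HasSummableCorrelations`: its indicator has density `σ > 0`, and the centred indicator has
autocorrelations `c (a - b)` with `c` summable. Randomness enters only in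
`ae_hasSummableCorrelations_natPart`. There `c d = σ δ₀(d) - |f̂ d|²`, and Parseval makes this
summable because `f` is bounded. These limits are countably many, so a single null set serves every
dynamical system and every `t`.

The limits come from a second-moment law of large numbers, `ae_tendsto_average_of_covariance`. For
products of two occupation variables it needs four-point functions: a `4 × 4` correlation
determinant is the product of its diagonal `2 × 2` minors up to an error quadratic in the
off-diagonal Fourier coefficients, hence again summable.

Given such a set, a van der Corput estimate (`tendsto_weighted_average_zero`) shows that the centred
indicator averages every orbit of a Hilbert space isometry to zero. Averages along the set therefore
have the same limit as ordinary ones, namely the projection on the fixed space by von Neumann's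
theorem. The Koopman isometry gives exactness and recurrence, and a rotation of `ℂ` gives the Wiener
averages. -/

/-! ### A strong law of large numbers under summable covariances. -/

theorem summable_inv_floor_pow {a : ℝ} (ha : 1 < a) :
    Summable fun k : ℕ => ((⌊a ^ k⌋₊ : ℝ))⁻¹ := by
  have hs : Summable fun k : ℕ => 2 * (a⁻¹) ^ k :=
    (summable_geometric_of_lt_one (by positivity) (inv_lt_one_of_one_lt₀ ha)).mul_left 2
  refine hs.of_nonneg_of_le (fun k => by positivity) fun k => ?_
  have h1 : (1 : ℝ) ≤ a ^ k := one_le_pow₀ ha.le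
  have h2 : (1 : ℝ) ≤ ⌊a ^ k⌋₊ := by exact_mod_cast Nat.floor_pos.2 h1
  have h3 := Nat.lt_floor_add_one (a ^ k)
  rw [inv_pow, ← div_eq_mul_inv, inv_eq_one_div, div_le_div_iff₀ (by positivity) (by positivity)]
  linarith

/-- By Tonelli the sum of the `Z k` has finite integral, so it is finite almost everywhere and its
terms tend to zero. This plays the role of Chebyshev with Borel–Cantelli. -/
theorem ae_tendsto_zero_of_summable_integral {Ω : Type*} [MeasurableSpace Ω] {P : Measure Ω}
    {Z : ℕ → Ω → ℝ} (hZ : ∀ k, Integrable (Z k) P) (h0 : ∀ k ω, 0 ≤ Z k ω)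
    {b : ℕ → ℝ} (hb : Summable b) (hZb : ∀ k, ∫ ω, Z k ω ∂P ≤ b k) :
    ∀ᵐ ω ∂P, Tendsto (fun k => Z k ω) atTop (𝓝 0) := by
  have hb0 : ∀ k, 0 ≤ b k := fun k => (integral_nonneg (h0 k)).trans (hZb k)
  have hfin : ∫⁻ ω, ∑' k, ENNReal.ofReal (Z k ω) ∂P ≠ ⊤ := by
    rw [lintegral_tsum fun k => (hZ k).aemeasurable.ennreal_ofReal]
    refine ne_top_of_le_ne_top hb.tsum_ofReal_ne_top (ENNReal.tsum_le_tsum fun k => ?_)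
    rw [← ofReal_integral_eq_lintegral_ofReal (hZ k) (ae_of_all _ (h0 k))]
    exact ENNReal.ofReal_le_ofReal (hZb k)
  have hm : AEMeasurable (fun ω => ∑' k, ENNReal.ofReal (Z k ω)) P :=
    AEMeasurable.tsum fun k => (hZ k).aemeasurable.ennreal_ofReal
  filter_upwards [ae_lt_top' hm hfin] with ω hω
  have := ENNReal.tendsto_atTop_zero_of_tsum_ne_top hω.ne
  have h2 := (ENNReal.tendsto_toReal ENNReal.zero_ne_top).comp this
  simpa [Function.comp_def, ENNReal.toReal_ofReal, h0] using h2

/-- A strong law of large numbers for bounded variables with summable covariances. -/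
theorem ae_tendsto_average_of_covariance {Ω : Type*} [MeasurableSpace Ω] {P : Measure Ω}
    [IsProbabilityMeasure P] {Y : ℕ → Ω → ℝ} (hY : ∀ n, Measurable (Y n))
    (h0 : ∀ n ω, 0 ≤ Y n ω) (h1 : ∀ n ω, Y n ω ≤ 1) {c : ℝ} (hc : ∀ n, ∫ ω, Y n ω ∂P = c)
    {γ : ℤ → ℝ} (hγ0 : ∀ d, 0 ≤ γ d) (hγ : Summable γ)
    (hcov : ∀ n m : ℕ, |∫ ω, Y n ω * Y m ω ∂P - c ^ 2| ≤ γ ((m : ℤ) - n)) :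
    ∀ᵐ ω ∂P, Tendsto (fun N : ℕ => (∑ n ∈ Finset.range N, Y n ω) / N) atTop (𝓝 c) := by
  have hint : ∀ n, Integrable (Y n) P := fun n =>
    Integrable.of_bound (hY n).aestronglyMeasurable 1
      (ae_of_all _ fun ω => by rw [Real.norm_of_nonneg (h0 n ω)]; exact h1 n ω)
  have hint2 : ∀ n m, Integrable (fun ω => Y n ω * Y m ω) P := fun n m =>
    (hint n).mul_bdd (hY m).aestronglyMeasurable (c := 1)
      (ae_of_all _ fun ω => by rw [Real.norm_of_nonneg (h0 m ω)]; exact h1 m ω)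
  have hprod : ∀ n m, (fun ω => (Y n ω - c) * (Y m ω - c)) =
      fun ω => Y n ω * Y m ω - c * Y n ω - c * Y m ω + c ^ 2 := by
    intro n m; ext ω; ring
  have hintp : ∀ n m, Integrable (fun ω => (Y n ω - c) * (Y m ω - c)) P := by
    intro n m
    rw [hprod]
    exact (((hint2 n m).sub ((hint n).const_mul c)).sub ((hint m).const_mul c)).add
      (integrable_const _)
  have hcovp : ∀ n m, ∫ ω, (Y n ω - c) * (Y m ω - c) ∂P = ∫ ω, Y n ω * Y m ω ∂P - c ^ 2 := by
    intro n m
    rw [hprod, integral_add, integral_sub, integral_sub, integral_const_mul, integral_const_mul,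
      hc, hc]
    · simp; ring
    · exact hint2 n m
    · exact (hint n).const_mul c
    · exact (hint2 n m).sub ((hint n).const_mul c)
    · exact (hint m).const_mul c
    · exact ((hint2 n m).sub ((hint n).const_mul c)).sub ((hint m).const_mul c)
    · exact integrable_const _
  have hsq : ∀ N : ℕ, (fun ω => (∑ n ∈ Finset.range N, (Y n ω - c)) ^ 2) =
      fun ω => ∑ n ∈ Finset.range N, ∑ m ∈ Finset.range N, (Y n ω - c) * (Y m ω - c) := by
    intro N; ext ω; rw [sq, Finset.sum_mul_sum]
  have hsqint : ∀ N : ℕ, Integrable (fun ω => (∑ n ∈ Finset.range N, (Y n ω - c)) ^ 2) P := by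
    intro N
    rw [hsq]
    exact integrable_finsetSum _ fun n _ => integrable_finsetSum _ fun m _ => hintp n m
  have hvar : ∀ N : ℕ, ∫ ω, (∑ n ∈ Finset.range N, (Y n ω - c)) ^ 2 ∂P ≤ N * ∑' d, γ d := by
    intro N
    rw [hsq, integral_finsetSum _ fun n _ => integrable_finsetSum _ fun m _ => hintp n m]
    calc _ ≤ ∑ n ∈ Finset.range N, ∑' d, γ d := Finset.sum_le_sum fun n _ => ?_
      _ = _ := by simp
    rw [integral_finsetSum _ fun m _ => hintp n m]
    calc _ ≤ ∑ m ∈ Finset.range N, γ ((m : ℤ) - n) :=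
          Finset.sum_le_sum fun m _ => by
            rw [hcovp]; exact (le_abs_self _).trans (hcov n m)
      _ = ∑ d ∈ (Finset.range N).image (fun m : ℕ => (m : ℤ) - n), γ d := by
          rw [Finset.sum_image]
          intro x _ y _ h
          simpa using h
      _ ≤ _ := hγ.sum_le_tsum _ fun d _ => hγ0 d
  have hsub : ∀ a : ℝ, 1 < a → ∀ᵐ ω ∂P, Tendsto
      (fun k : ℕ => (∑ n ∈ Finset.range ⌊a ^ k⌋₊, Y n ω) / ⌊a ^ k⌋₊) atTop (𝓝 c) := by
    intro a ha
    have hpos : ∀ k : ℕ, (0 : ℝ) < ⌊a ^ k⌋₊ := fun k => by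
      exact_mod_cast Nat.floor_pos.2 (one_le_pow₀ ha.le)
    -- The variance of the sum grows at most linearly, so the mean square of the average is `O(1 /
    -- ⌊a ^ k⌋₊)`, which is summable along a geometric subsequence.
    have key := ae_tendsto_zero_of_summable_integral (P := P)
      (Z := fun k ω => (∑ n ∈ Finset.range ⌊a ^ k⌋₊, (Y n ω - c)) ^ 2 * ((⌊a ^ k⌋₊ : ℝ)⁻¹ ^ 2))
      (fun k => (hsqint _).mul_const _) (fun k ω => by positivity)
      ((summable_inv_floor_pow ha).mul_left (∑' d, γ d)) (fun k => by
        rw [integral_mul_const]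
        refine (mul_le_mul_of_nonneg_right (hvar _) (by positivity)).trans_eq ?_
        have := (hpos k).ne'
        field_simp)
    filter_upwards [key] with ω hω
    have h2 := hω.sqrt
    simp only [← mul_pow, Real.sqrt_sq_eq_abs, Real.sqrt_zero] at h2
    have h3 := ((tendsto_zero_iff_abs_tendsto_zero _).2 h2).add_const c
    rw [zero_add] at h3
    refine h3.congr fun k => ?_
    have := (hpos k).ne'
    simp only [Finset.sum_sub_distrib, Finset.sum_const, Finset.card_range, nsmul_eq_mul]
    field_simp
    ring
  have hall : ∀ᵐ ω ∂P, ∀ j : ℕ, Tendsto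
      (fun k : ℕ => (∑ n ∈ Finset.range ⌊(1 + ((j : ℝ) + 1)⁻¹) ^ k⌋₊, Y n ω) /
        ⌊(1 + ((j : ℝ) + 1)⁻¹) ^ k⌋₊) atTop (𝓝 c) :=
    ae_all_iff.2 fun j => hsub _ (by simpa using by positivity)
  -- Partial sums are monotone because `Y ≥ 0`, so convergence along geometric subsequences with
  -- ratios decreasing to `1` fills the gaps.
  filter_upwards [hall] with ω hω
  refine tendsto_div_of_monotone_of_tendsto_div_floor_pow (fun N => ∑ n ∈ Finset.range N, Y n ω) c
    (fun m n hmn => Finset.sum_le_sum_of_subset_of_nonneg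
      (Finset.range_mono hmn) fun i _ _ => h0 i ω) (fun j : ℕ => 1 + ((j : ℝ) + 1)⁻¹)
    (fun j => by simpa using by positivity) ?_ hω
  have := tendsto_one_div_add_atTop_nhds_zero_nat (𝕜 := ℝ)
  simpa using this.const_add 1

/-! ### Near-factorization of `4 × 4` determinants. -/

/-- Laplace expansion along the first two rows. In every term but the first, each of the two minors
has a column in an off-diagonal block. With entries bounded by `1`, each such minor is at most `2β`,
and five terms of size `4β²` give the later constant `20`. -/
theorem Matrix.det_fin_four_laplace {R : Type*} [CommRing R] (M : Matrix (Fin 4) (Fin 4) R) :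
    M.det = (M 0 0 * M 1 1 - M 0 1 * M 1 0) * (M 2 2 * M 3 3 - M 2 3 * M 3 2)
      - (M 0 0 * M 1 2 - M 0 2 * M 1 0) * (M 2 1 * M 3 3 - M 2 3 * M 3 1)
      + (M 0 0 * M 1 3 - M 0 3 * M 1 0) * (M 2 1 * M 3 2 - M 2 2 * M 3 1)
      + (M 0 1 * M 1 2 - M 0 2 * M 1 1) * (M 2 0 * M 3 3 - M 2 3 * M 3 0)
      - (M 0 1 * M 1 3 - M 0 3 * M 1 1) * (M 2 0 * M 3 2 - M 2 2 * M 3 0)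
      + (M 0 2 * M 1 3 - M 0 3 * M 1 2) * (M 2 0 * M 3 1 - M 2 1 * M 3 0) := by
  have e1 : (Fin.succAbove (1 : Fin 4) : Fin 3 → Fin 4) = ![0, 2, 3] := by decide
  have e2 : (Fin.succAbove (2 : Fin 4) : Fin 3 → Fin 4) = ![0, 1, 3] := by decide
  have e3 : (Fin.succAbove (3 : Fin 4) : Fin 3 → Fin 4) = ![0, 1, 2] := by decide
  have e0 : (Fin.succAbove (0 : Fin 4) : Fin 3 → Fin 4) = ![1, 2, 3] := by decide
  have es : (Fin.succ : Fin 3 → Fin 4) = ![1, 2, 3] := by decide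
  rw [Matrix.det_succ_row_zero]
  simp only [Fin.sum_univ_four, Matrix.det_fin_three, Matrix.submatrix_apply, e0, e1, e2, e3, es]
  simp
  ring

theorem norm_mul_sub_mul_le {x y z w : ℂ} {β : ℝ} (h₁ : ‖x * y‖ ≤ β) (h₂ : ‖z * w‖ ≤ β) :
    ‖x * y - z * w‖ ≤ 2 * β :=
  (norm_sub_le _ _).trans (by linarith)

theorem norm_mul_le_of_le_of_le_one {x y : ℂ} {β : ℝ} (hx : ‖x‖ ≤ β) (hy : ‖y‖ ≤ 1) :
    ‖x * y‖ ≤ β := by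
  rw [norm_mul]
  exact (mul_le_of_le_one_right (norm_nonneg _) hy).trans hx

/-- The determinant of a `4 × 4` matrix differs from the product of the determinants of its
diagonal `2 × 2` blocks by a quadratic quantity in the off-diagonal blocks. -/
theorem Matrix.norm_det_sub_det_mul_det_le (M : Matrix (Fin 4) (Fin 4) ℂ) (h1 : ∀ i j, ‖M i j‖ ≤ 1)
    {β : ℝ} (h02 : ‖M 0 2‖ ≤ β) (h03 : ‖M 0 3‖ ≤ β) (h12 : ‖M 1 2‖ ≤ β) (h13 : ‖M 1 3‖ ≤ β)
    (h20 : ‖M 2 0‖ ≤ β) (h21 : ‖M 2 1‖ ≤ β) (h30 : ‖M 3 0‖ ≤ β) (h31 : ‖M 3 1‖ ≤ β) :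
    ‖M.det - (M 0 0 * M 1 1 - M 0 1 * M 1 0) * (M 2 2 * M 3 3 - M 2 3 * M 3 2)‖ ≤ 20 * β ^ 2 := by
  have hβ : 0 ≤ β := (norm_nonneg _).trans h02
  have L : ∀ {i j : Fin 4}, ‖M i j‖ ≤ β → ∀ k l, ‖M i j * M k l‖ ≤ β := fun h k l =>
    norm_mul_le_of_le_of_le_one h (h1 k l)
  have R : ∀ {i j : Fin 4}, ‖M i j‖ ≤ β → ∀ k l, ‖M k l * M i j‖ ≤ β := fun h k l => by
    rw [mul_comm]; exact L h k l
  have T : ∀ {x y : ℂ}, ‖x‖ ≤ 2 * β → ‖y‖ ≤ 2 * β → ‖x * y‖ ≤ 4 * β ^ 2 := fun {x y} hx hy => by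
    rw [norm_mul]
    exact (mul_le_mul hx hy (norm_nonneg _) (by positivity)).trans_eq (by ring)
  have t1 := T (norm_mul_sub_mul_le (R h12 0 0) (L h02 1 0))
    (norm_mul_sub_mul_le (L h21 3 3) (R h31 2 3))
  have t2 := T (norm_mul_sub_mul_le (R h13 0 0) (L h03 1 0))
    (norm_mul_sub_mul_le (L h21 3 2) (R h31 2 2))
  have t3 := T (norm_mul_sub_mul_le (R h12 0 1) (L h02 1 1))
    (norm_mul_sub_mul_le (L h20 3 3) (R h30 2 3))
  have t4 := T (norm_mul_sub_mul_le (R h13 0 1) (L h03 1 1))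
    (norm_mul_sub_mul_le (L h20 3 2) (R h30 2 2))
  have t5 := T (norm_mul_sub_mul_le (R h13 0 2) (L h03 1 2))
    (norm_mul_sub_mul_le (L h20 3 1) (R h30 2 1))
  have key : ∀ a b c d e f : ℂ, ‖a - b + c + d - e + f - a‖ ≤ ‖b‖ + ‖c‖ + ‖d‖ + ‖e‖ + ‖f‖ := by
    intro a b c d e f
    have : a - b + c + d - e + f - a = -b + c + d + -e + f := by ring
    rw [this]
    refine (norm_add_le _ _).trans (add_le_add_left ?_ _)
    refine (norm_add_le _ _).trans (add_le_add ?_ (norm_neg e).le)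
    refine (norm_add_le _ _).trans (add_le_add_left ?_ _)
    refine (norm_add_le _ _).trans (add_le_add_left (norm_neg b).le _)
  rw [Matrix.det_fin_four_laplace]
  refine (key _ _ _ _ _ _).trans ?_
  linarith

/-! ### Fourier coefficients of the symbol. -/

section Fourier

variable {f : UnitAddCircle → ℝ}

theorem memLp_ofReal_of_mem_Icc (hf_meas : Measurable f) (hf : ∀ t, f t ∈ Set.Icc (0 : ℝ) 1)
    (p : ENNReal) :
    MemLp (fun t => (f t : ℂ)) p (AddCircle.haarAddCircle : Measure UnitAddCircle) :=
  MemLp.of_bound (Complex.measurable_ofReal.comp hf_meas).aestronglyMeasurable 1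
    (ae_of_all _ fun t => by
      rw [Complex.norm_real, Real.norm_of_nonneg (hf t).1]; exact (hf t).2)

theorem summable_sq_norm_fourierCoeff (hf_meas : Measurable f)
    (hf : ∀ t, f t ∈ Set.Icc (0 : ℝ) 1) :
    Summable fun k : ℤ => ‖fourierCoeff (fun t => (f t : ℂ)) k‖ ^ 2 := by
  have hL := memLp_ofReal_of_mem_Icc hf_meas hf 2
  refine (hasSum_sq_fourierCoeff hL.toLp).summable.congr fun k => ?_
  congr 2
  refine integral_congr_ae ?_
  filter_upwards [hL.coeFn_toLp] with t ht
  rw [ht]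

theorem norm_fourierCoeff_le_one (hf : ∀ t, f t ∈ Set.Icc (0 : ℝ) 1) (k : ℤ) :
    ‖fourierCoeff (fun t => (f t : ℂ)) k‖ ≤ 1 := by
  refine (norm_integral_le_of_norm_le_const (C := 1) (ae_of_all _ fun t => ?_)).trans (by simp)
  rw [norm_smul, Complex.norm_real, Real.norm_of_nonneg (hf t).1]
  rw [fourier_apply, Circle.norm_coe, one_mul]
  exact (hf t).2

theorem fourierCoeff_ofReal_neg (f : UnitAddCircle → ℝ) (k : ℤ) :
    fourierCoeff (fun t => (f t : ℂ)) (-k) =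
      (starRingEnd ℂ) (fourierCoeff (fun t => (f t : ℂ)) k) := by
  simp only [fourierCoeff, ← integral_conj, smul_eq_mul, map_mul, Complex.conj_ofReal, fourier_neg,
    Complex.conj_conj]

theorem fourierCoeff_ofReal_zero (f : UnitAddCircle → ℝ) :
    fourierCoeff (fun t => (f t : ℂ)) 0 =
      ((∫ t, f t ∂(AddCircle.haarAddCircle : Measure UnitAddCircle) : ℝ) : ℂ) := by
  simp [fourierCoeff, integral_complex_ofReal]

theorem norm_fourierCoeff_ofReal_neg (f : UnitAddCircle → ℝ) (k : ℤ) :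
    ‖fourierCoeff (fun t => (f t : ℂ)) (-k)‖ = ‖fourierCoeff (fun t => (f t : ℂ)) k‖ := by
  rw [fourierCoeff_ofReal_neg, RCLike.norm_conj]

end Fourier

/-! ### Occupation variables and their moments. -/

open scoped Classical in
/-- The indicator `ξ_n` of the event `n ∈ 𝔛`. -/
noncomputable def occupation {Ω : Type*} (𝔛 : Ω → Set ℤ) (n : ℤ) (ω : Ω) : ℝ :=
  if n ∈ 𝔛 ω then 1 else 0

section Occupation

variable {Ω : Type*} {𝔛 : Ω → Set ℤ}

theorem occupation_nonneg (n : ℤ) (ω : Ω) : 0 ≤ occupation 𝔛 n ω := by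
  unfold occupation; split_ifs <;> norm_num

theorem occupation_le_one (n : ℤ) (ω : Ω) : occupation 𝔛 n ω ≤ 1 := by
  unfold occupation; split_ifs <;> norm_num

theorem occupation_mul_self (n : ℤ) (ω : Ω) :
    occupation 𝔛 n ω * occupation 𝔛 n ω = occupation 𝔛 n ω := by
  unfold occupation; split_ifs <;> norm_num

variable [MeasurableSpace Ω] {P : Measure Ω} {K : ℤ → ℤ → ℂ}

theorem IsDeterminantalProcess.measurable_occupation (h : IsDeterminantalProcess P K 𝔛) (n : ℤ) :
    Measurable (occupation 𝔛 n) :=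
  Measurable.ite (h.measurableSet_mem n) measurable_const measurable_const

theorem IsDeterminantalProcess.integral_prod_occupation (h : IsDeterminantalProcess P K 𝔛) {k : ℕ}
    {n : Fin k → ℤ} (hn : Function.Injective n) :
    ((∫ ω, ∏ i, occupation 𝔛 (n i) ω ∂P : ℝ) : ℂ) =
      (Matrix.of fun i j => K (n i) (n j)).det := by
  rw [← h.correlation k n hn]
  congr 1
  have hm : MeasurableSet {ω | ∀ i, n i ∈ 𝔛 ω} := by
    rw [show {ω | ∀ i, n i ∈ 𝔛 ω} = ⋂ i, {ω | n i ∈ 𝔛 ω} by ext; simp]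
    exact MeasurableSet.iInter fun i => h.measurableSet_mem _
  rw [← integral_indicator_one hm]
  congr 1
  ext ω
  classical
  simp only [occupation, Set.indicator_apply, Set.mem_ofPred_eq, Finset.prod_ite_zero,
    Finset.mem_univ, true_imp_iff]
  simp

end Occupation

/-! ### Almost sure one- and two-point averages of the process. -/

section Toeplitz

variable {Ω : Type*} [MeasurableSpace Ω] {P : Measure Ω} {𝔛 : Ω → Set ℤ} {f : UnitAddCircle → ℝ}

local notation "σ" => ∫ t, f t ∂(AddCircle.haarAddCircle : Measure UnitAddCircle)
local notation "F" => fourierCoeff (fun t => (f t : ℂ))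

theorem integral_occupation (h : IsDeterminantalProcess P (toeplitzKernel f) 𝔛) (n : ℤ) :
    ∫ ω, occupation 𝔛 n ω ∂P = σ := by
  have := h.integral_prod_occupation (n := ![n]) (Function.injective_of_subsingleton _)
  simp only [Matrix.det_unique, Matrix.of_apply, toeplitzKernel, sub_self,
    fourierCoeff_ofReal_zero, Finset.univ_unique, Finset.prod_singleton] at this
  exact_mod_cast this

theorem integral_occupation_mul (h : IsDeterminantalProcess P (toeplitzKernel f) 𝔛) {n m : ℤ}
    (hnm : n ≠ m) :
    ∫ ω, occupation 𝔛 n ω * occupation 𝔛 m ω ∂P = σ ^ 2 - ‖F (n - m)‖ ^ 2 := by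
  have hinj : Function.Injective ![n, m] := by
    intro i j; fin_cases i <;> fin_cases j <;> simp [hnm, hnm.symm]
  have := h.integral_prod_occupation hinj
  simp only [Matrix.det_fin_two, Matrix.of_apply, toeplitzKernel, sub_self,
    fourierCoeff_ofReal_zero, Fin.prod_univ_two, Matrix.cons_val_zero, Matrix.cons_val_one] at this
  rw [← neg_sub n m, fourierCoeff_ofReal_neg, Complex.mul_conj, Complex.normSq_eq_norm_sq] at this
  rw [sq σ]
  exact_mod_cast this

/-- Decorrelation of the pairs `{a, b}` and `{c, d}`: the hypotheses bound one off-diagonal block,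
and Hermitian symmetry of the kernel bounds the other. -/
theorem abs_integral_occupation_four_sub_le (hf : ∀ t, f t ∈ Set.Icc (0 : ℝ) 1)
    (h : IsDeterminantalProcess P (toeplitzKernel f) 𝔛) {a b c d : ℤ}
    (hab : a ≠ b) (hac : a ≠ c) (had : a ≠ d) (hbc : b ≠ c) (hbd : b ≠ d) (hcd : c ≠ d) {β : ℝ}
    (h1 : ‖F (c - a)‖ ≤ β) (h2 : ‖F (d - a)‖ ≤ β) (h3 : ‖F (c - b)‖ ≤ β) (h4 : ‖F (d - b)‖ ≤ β) :
    |∫ ω, (occupation 𝔛 a ω * occupation 𝔛 b ω) * (occupation 𝔛 c ω * occupation 𝔛 d ω) ∂P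
      - (∫ ω, occupation 𝔛 a ω * occupation 𝔛 b ω ∂P) *
        ∫ ω, occupation 𝔛 c ω * occupation 𝔛 d ω ∂P| ≤ 20 * β ^ 2 := by
  have hinj : Function.Injective ![a, b, c, d] := by
    intro i j
    fin_cases i <;> fin_cases j <;>
      simp [hab, hab.symm, hac, hac.symm, had, had.symm, hbc, hbc.symm, hbd, hbd.symm, hcd,
        hcd.symm]
  have hinj2 : ∀ {x y : ℤ}, x ≠ y → Function.Injective ![x, y] := by
    intro x y hxy i j
    fin_cases i <;> fin_cases j <;> simp [hxy, hxy.symm]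
  have e4 := h.integral_prod_occupation hinj
  have e2 := h.integral_prod_occupation (hinj2 hab)
  have e3 := h.integral_prod_occupation (hinj2 hcd)
  have key := Matrix.norm_det_sub_det_mul_det_le
    (Matrix.of fun i j => toeplitzKernel f (![a, b, c, d] i) (![a, b, c, d] j)) (β := β)
    (fun i j => norm_fourierCoeff_le_one hf _)
    (by rw [← norm_fourierCoeff_ofReal_neg] at h1; simpa [toeplitzKernel] using h1)
    (by rw [← norm_fourierCoeff_ofReal_neg] at h2; simpa [toeplitzKernel] using h2)
    (by rw [← norm_fourierCoeff_ofReal_neg] at h3; simpa [toeplitzKernel] using h3)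
    (by rw [← norm_fourierCoeff_ofReal_neg] at h4; simpa [toeplitzKernel] using h4)
    (by simpa [toeplitzKernel] using h1) (by simpa [toeplitzKernel] using h3)
    (by simpa [toeplitzKernel] using h2) (by simpa [toeplitzKernel] using h4)
  rw [← e4] at key
  rw [Matrix.det_fin_two] at e2 e3
  simp only [Fin.prod_univ_four, Fin.prod_univ_two, Matrix.of_apply, Matrix.cons_val_zero,
    Matrix.cons_val_one, Matrix.cons_val] at key e2 e3
  rw [← e2, ← e3, ← Complex.ofReal_mul, ← Complex.ofReal_sub, Complex.norm_real,
    Real.norm_eq_abs] at key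
  simpa only [mul_assoc] using key

theorem single_one_nonneg (e d : ℤ) : 0 ≤ (Pi.single e 1 : ℤ → ℝ) d := by
  rw [Pi.single_apply]
  split_ifs <;> norm_num

/-- A crude bound for the finitely many differences `m - n` at which indices coincide and the
determinantal formula does not apply. -/
theorem integral_mul_sub_sq_le_one [IsProbabilityMeasure P] {Y Z : Ω → ℝ} {c : ℝ}
    (hY : Measurable Y) (hY0 : ∀ ω, 0 ≤ Y ω) (hY1 : ∀ ω, Y ω ≤ 1)
    (hZ0 : ∀ ω, 0 ≤ Z ω) (hZ1 : ∀ ω, Z ω ≤ 1) (hc : ∫ ω, Y ω ∂P = c) :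
    |∫ ω, Y ω * Z ω ∂P - c ^ 2| ≤ 1 := by
  have hi : Integrable Y P := Integrable.of_bound hY.aestronglyMeasurable 1
      (ae_of_all _ fun ω => by rw [Real.norm_of_nonneg (hY0 ω)]; exact hY1 ω)
  have hc0 : 0 ≤ c := hc ▸ integral_nonneg hY0
  have hc1 : c ≤ 1 := by
    rw [← hc]
    exact (integral_mono hi (integrable_const 1) hY1).trans (by simp)
  have h0 : 0 ≤ ∫ ω, Y ω * Z ω ∂P := integral_nonneg fun ω => mul_nonneg (hY0 ω) (hZ0 ω)
  have h1 : ∫ ω, Y ω * Z ω ∂P ≤ c := by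
    rw [← hc]
    exact integral_mono_of_nonneg (ae_of_all _ fun ω => mul_nonneg (hY0 ω) (hZ0 ω)) hi
      (ae_of_all _ fun ω => mul_le_of_le_one_right (hY0 ω) (hZ1 ω))
  rw [abs_le]
  constructor <;> nlinarith

theorem ae_tendsto_average_occupation [IsProbabilityMeasure P] (hf_meas : Measurable f)
    (hf : ∀ t, f t ∈ Set.Icc (0 : ℝ) 1)
    (h : IsDeterminantalProcess P (toeplitzKernel f) 𝔛) (a : ℤ) :
    ∀ᵐ ω ∂P, Tendsto (fun N : ℕ => (∑ n ∈ Finset.range N, occupation 𝔛 (n + a) ω) / N) atTop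
      (𝓝 σ) := by
  have hs := summable_sq_norm_fourierCoeff hf_meas hf
  -- The point mass at `0` absorbs the diagonal `n = m`; off it the covariance is exactly `-|f̂|²`.
  refine ae_tendsto_average_of_covariance (Y := fun n => occupation 𝔛 (n + a))
    (γ := fun d => ‖F d‖ ^ 2 + (Pi.single 0 1 : ℤ → ℝ) d) (fun n => h.measurable_occupation _)
    (fun n => occupation_nonneg _) (fun n => occupation_le_one _)
    (fun n => integral_occupation h _)
    (fun d => add_nonneg (by positivity) (single_one_nonneg _ d))
    (hs.add (show Summable fun d => (Pi.single 0 1 : ℤ → ℝ) d from (hasSum_pi_single 0 1).summable)) fun n m => ?_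
  rcases eq_or_ne n m with rfl | hnm
  · refine (integral_mul_sub_sq_le_one (h.measurable_occupation _) (occupation_nonneg _)
      (occupation_le_one _) (occupation_nonneg _) (occupation_le_one _)
      (integral_occupation h _)).trans ?_
    simp
  · have hnm' : (n : ℤ) ≠ m := by exact_mod_cast hnm
    rw [integral_occupation_mul h (by simpa using hnm)]
    rw [Pi.single_eq_of_ne (sub_ne_zero.2 hnm'.symm), add_sub_add_right_eq_sub,
      ← norm_fourierCoeff_ofReal_neg, neg_sub]
    simp

theorem ae_tendsto_average_occupation_mul [IsProbabilityMeasure P] (hf_meas : Measurable f)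
    (hf : ∀ t, f t ∈ Set.Icc (0 : ℝ) 1)
    (h : IsDeterminantalProcess P (toeplitzKernel f) 𝔛) {a b : ℤ} (hab : a ≠ b) :
    ∀ᵐ ω ∂P, Tendsto (fun N : ℕ => (∑ n ∈ Finset.range N,
      occupation 𝔛 (n + a) ω * occupation 𝔛 (n + b) ω) / N) atTop
      (𝓝 (σ ^ 2 - ‖F (a - b)‖ ^ 2)) := by
  have hs := summable_sq_norm_fourierCoeff hf_meas hf
  have hshift : ∀ e : ℤ, Summable fun d : ℤ =>
      60 * ‖F (d + e)‖ ^ 2 + (Pi.single (-e) 1 : ℤ → ℝ) d :=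
    fun e => (((Equiv.addRight e).summable_iff.2 hs).mul_left 60).add 
      (show Summable fun d => (Pi.single (-e) 1 : ℤ → ℝ) d from (hasSum_pi_single (-e) 1).summable)
  have hn : ∀ e d : ℤ, 0 ≤ 60 * ‖F (d + e)‖ ^ 2 + (Pi.single (-e) 1 : ℤ → ℝ) d := fun e d =>
    add_nonneg (by positivity) (single_one_nonneg _ d)
  have hmem : ∀ x y : ℤ, (∀ ω, 0 ≤ occupation 𝔛 x ω * occupation 𝔛 y ω) ∧
      ∀ ω, occupation 𝔛 x ω * occupation 𝔛 y ω ≤ 1 := fun x y =>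
    ⟨fun ω => mul_nonneg (occupation_nonneg _ _) (occupation_nonneg _ _), fun ω =>
      mul_le_one₀ (occupation_le_one _ _) (occupation_nonneg _ _) (occupation_le_one _ _)⟩
  have hexp : ∀ n : ℕ, ∫ ω, occupation 𝔛 (n + a) ω * occupation 𝔛 (n + b) ω ∂P =
      σ ^ 2 - ‖F (a - b)‖ ^ 2 := fun n => by
    rw [integral_occupation_mul h (by simpa using hab), add_sub_add_left_eq_sub]
  -- The point masses cover the three differences at which the pairs `n + a, n + b` and `m + a, m +
  -- b` overlap. Elsewhere `β = x + y + z` dominates the four cross coefficients, and `20 (x + y +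
  -- z)² ≤ 60 (x² + y² + z²)`.
  refine ae_tendsto_average_of_covariance
    (Y := fun (n : ℕ) ω => occupation 𝔛 (n + a) ω * occupation 𝔛 (n + b) ω)
    (γ := fun d => (60 * ‖F (d + 0)‖ ^ 2 + (Pi.single (-0) 1 : ℤ → ℝ) d) +
      (60 * ‖F (d + (b - a))‖ ^ 2 + (Pi.single (-(b - a)) 1 : ℤ → ℝ) d) +
      (60 * ‖F (d + (a - b))‖ ^ 2 + (Pi.single (-(a - b)) 1 : ℤ → ℝ) d))
    (fun n => (h.measurable_occupation _).mul (h.measurable_occupation _))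
    (fun n => (hmem _ _).1) (fun n => (hmem _ _).2) hexp
    (fun d => add_nonneg (add_nonneg (hn _ _) (hn _ _)) (hn _ _))
    (((hshift 0).add (hshift _)).add (hshift _)) fun n m => ?_
  have hone : ∀ e : ℤ, (m : ℤ) - n = -e →
      1 ≤ 60 * ‖F ((m : ℤ) - n + e)‖ ^ 2 + (Pi.single (-e) 1 : ℤ → ℝ) ((m : ℤ) - n) := by
    intro e he
    rw [he, Pi.single_eq_same]
    have : 0 ≤ ‖F (-e + e)‖ ^ 2 := by positivity
    linarith
  have hle1 := integral_mul_sub_sq_le_one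
    ((h.measurable_occupation (n + a)).mul (h.measurable_occupation (n + b)))
    (hmem _ _).1 (hmem _ _).2 (hmem (m + a) (m + b)).1 (hmem _ _).2 (hexp n)
  simp only [Pi.mul_apply] at hle1
  by_cases e0 : (m : ℤ) - n = -0
  · linarith [hone 0 e0, hn (b - a) (m - n), hn (a - b) (m - n), hle1]
  by_cases e1 : (m : ℤ) - n = -(b - a)
  · linarith [hone _ e1, hn 0 (m - n), hn (a - b) (m - n), hle1]
  by_cases e2 : (m : ℤ) - n = -(a - b)
  · linarith [hone _ e2, hn 0 (m - n), hn (b - a) (m - n), hle1]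
  rw [Pi.single_eq_of_ne e0, Pi.single_eq_of_ne e1, Pi.single_eq_of_ne e2]
  set x := ‖F ((m : ℤ) - n + 0)‖ with hx
  set y := ‖F ((m : ℤ) - n + (b - a))‖ with hy
  set z := ‖F ((m : ℤ) - n + (a - b))‖ with hz
  have hx0 : 0 ≤ x := norm_nonneg _
  have hy0 : 0 ≤ y := norm_nonneg _
  have hz0 : 0 ≤ z := norm_nonneg _
  have key := abs_integral_occupation_four_sub_le hf h (a := n + a) (b := n + b) (c := m + a)
    (d := m + b) (β := x + y + z) (by omega) (by omega) (by omega) (by omega) (by omega) (by omega)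
    (by rw [show (m : ℤ) + a - (n + a) = m - n + 0 by ring, ← hx]; linarith)
    (by rw [show (m : ℤ) + b - (n + a) = m - n + (b - a) by ring, ← hy]; linarith)
    (by rw [show (m : ℤ) + a - (n + b) = m - n + (a - b) by ring, ← hz]; linarith)
    (by rw [show (m : ℤ) + b - (n + b) = m - n + 0 by ring, ← hx]; linarith)
  rw [hexp, hexp, ← sq] at key
  refine key.trans ?_
  nlinarith [sq_nonneg (x - y), sq_nonneg (y - z), sq_nonneg (x - z)]

end Toeplitz

/-! ### Van der Corput and mean ergodic theorems for isometries. -/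

theorem norm_sum_range_add_sub_le {E : Type*} [SeminormedAddCommGroup E] {u : ℕ → E} {C : ℝ}
    (hu : ∀ n, ‖u n‖ ≤ C) (N l : ℕ) :
    ‖∑ n ∈ Finset.range N, u n - ∑ n ∈ Finset.range N, u (n + l)‖ ≤ 2 * l * C := by
  have h1 := Finset.sum_range_add u N l
  have h2 := Finset.sum_range_add u l N
  rw [add_comm l N, h1] at h2
  have h3 : ∑ n ∈ Finset.range N, u n - ∑ n ∈ Finset.range N, u (n + l) =
      ∑ n ∈ Finset.range l, u n - ∑ n ∈ Finset.range l, u (N + n) := by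
    simp_rw [add_comm _ l]
    rw [sub_eq_sub_iff_add_eq_add, h2]
  rw [h3]
  refine (norm_sub_le _ _).trans ?_
  have h4 : ∀ v : ℕ → E, (∀ n, ‖v n‖ ≤ C) → ‖∑ n ∈ Finset.range l, v n‖ ≤ l * C := fun v hv =>
    (norm_sum_le_of_le _ fun n _ => hv n).trans (by simp)
  linarith [h4 u hu, h4 _ fun n => hu (N + n)]

section Hilbert

variable {H : Type*} [NormedAddCommGroup H] [InnerProductSpace ℂ H]

theorem LinearIsometry.norm_iterate (U : H →ₗᵢ[ℂ] H) (n : ℕ) (g : H) : ‖U^[n] g‖ = ‖g‖ := by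
  induction n with
  | zero => rfl
  | succ n ih => rw [Function.iterate_succ_apply', U.norm_map, ih]

theorem LinearIsometry.inner_iterate_add (U : H →ₗᵢ[ℂ] H) (n : ℕ) (a b : ℕ) (g : H) :
    inner ℂ (U^[n + a] g) (U^[n + b] g) = inner ℂ (U^[a] g) (U^[b] g) := by
  induction n with
  | zero => simp
  | succ n ih =>
    rw [Nat.succ_add, Nat.succ_add, Function.iterate_succ_apply', Function.iterate_succ_apply',
      U.inner_map_map, ih]

theorem sq_norm_average_le (w : ℕ → H) (N : ℕ) :
    ‖(N : ℝ)⁻¹ • ∑ n ∈ Finset.range N, w n‖ ^ 2 ≤ (∑ n ∈ Finset.range N, ‖w n‖ ^ 2) / N := by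
  rcases N.eq_zero_or_pos with rfl | hN
  · simp
  have hN' : (0 : ℝ) < N := by exact_mod_cast hN
  rw [norm_smul, mul_pow, norm_inv, Real.norm_natCast, inv_pow, ← div_eq_inv_mul,
    div_le_div_iff₀ (by positivity) hN']
  have h1 : ‖∑ n ∈ Finset.range N, w n‖ ^ 2 ≤ (∑ n ∈ Finset.range N, ‖w n‖) ^ 2 := by
    gcongr
    exact norm_sum_le _ _
  have h2 := sq_sum_le_card_mul_sum_sq (s := Finset.range N) (f := fun n => ‖w n‖)
  rw [Finset.card_range] at h2
  nlinarith

/-- The mean square of a block average of a weighted orbit of an isometry. -/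
theorem sum_sq_norm_block (U : H →ₗᵢ[ℂ] H) (g : H) (η : ℕ → ℝ) (L N : ℕ) :
    (∑ n ∈ Finset.range N,
      ‖(L : ℝ)⁻¹ • ∑ l ∈ Finset.range L, η (n + l) • U^[n + l] g‖ ^ 2) / N =
      ((L : ℝ)⁻¹) ^ 2 * ∑ a ∈ Finset.range L, ∑ b ∈ Finset.range L,
        (inner ℂ (U^[a] g) (U^[b] g)).re *
          ((∑ n ∈ Finset.range N, η (n + a) * η (n + b)) / N) := by
  have h : ∀ n, ‖(L : ℝ)⁻¹ • ∑ l ∈ Finset.range L, η (n + l) • U^[n + l] g‖ ^ 2 =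
      ((L : ℝ)⁻¹) ^ 2 * ∑ a ∈ Finset.range L, ∑ b ∈ Finset.range L,
        (inner ℂ (U^[a] g) (U^[b] g)).re * (η (n + a) * η (n + b)) := by
    intro n
    rw [norm_smul, mul_pow, Real.norm_eq_abs, sq_abs]
    congr 1
    rw [← inner_self_eq_norm_sq (𝕜 := ℂ), sum_inner, map_sum]
    refine Finset.sum_congr rfl fun a _ => ?_
    rw [inner_sum, map_sum]
    refine Finset.sum_congr rfl fun b _ => ?_
    -- The isometry removes `n` from the inner products, leaving the dependence on `n` to the
    -- weights alone.
    rw [← U.inner_iterate_add n a b g, ← Complex.coe_smul, ← Complex.coe_smul, inner_smul_left,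
      inner_smul_right, Complex.conj_ofReal]
    simp only [RCLike.re_to_complex, Complex.re_ofReal_mul]
    ring
  simp_rw [h]
  rw [← Finset.mul_sum, mul_div_assoc, Finset.sum_comm]
  congr 1
  rw [Finset.sum_div]
  refine Finset.sum_congr rfl fun a _ => ?_
  rw [Finset.sum_comm, Finset.sum_div]
  refine Finset.sum_congr rfl fun b _ => ?_
  rw [← Finset.mul_sum, mul_div_assoc]

/-- A van der Corput estimate: a bounded weight with summable autocorrelations averages every orbit
of an isometry to zero. -/
theorem tendsto_weighted_average_zero (U : H →ₗᵢ[ℂ] H) (g : H) {η : ℕ → ℝ}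
    (hη1 : ∀ n, |η n| ≤ 1) {c : ℤ → ℝ} (hc : Summable c)
    (hη : ∀ a b : ℕ, Tendsto (fun N : ℕ => (∑ n ∈ Finset.range N, η (n + a) * η (n + b)) / N) atTop
      (𝓝 (c ((a : ℤ) - b)))) :
    Tendsto (fun N : ℕ => (N : ℝ)⁻¹ • ∑ n ∈ Finset.range N, η n • U^[n] g) atTop (𝓝 0) := by
  set S := ∑' d, |c d| with hS
  have hS0 : 0 ≤ S := tsum_nonneg fun d => abs_nonneg _
  have hu : ∀ n, ‖η n • U^[n] g‖ ≤ ‖g‖ := fun n => by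
    rw [norm_smul, U.norm_iterate]
    exact mul_le_of_le_one_left (norm_nonneg _) (hη1 n)
  rw [tendsto_zero_iff_norm_tendsto_zero, Metric.tendsto_atTop']
  intro ε hε
  -- The block length makes the limiting mean square of the block averages, at most `‖g‖² S / L`,
  -- smaller than `ε²`. The `max` keeps `L` positive.
  obtain ⟨L, hL⟩ := exists_nat_gt (max 0 (‖g‖ ^ 2 * S / (ε ^ 2)))
  have hL0 : (0 : ℝ) < L := (le_max_left _ _).trans_lt hL
  have hLε : ‖g‖ ^ 2 * S / L < ε ^ 2 := by
    have h1 := (le_max_right _ _).trans_lt hL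
    rw [div_lt_iff₀ (by positivity)] at h1
    rw [div_lt_iff₀ hL0]
    linarith
  set w : ℕ → H := fun n => (L : ℝ)⁻¹ • ∑ l ∈ Finset.range L, η (n + l) • U^[n + l] g with hw
  have hlim : Tendsto (fun N : ℕ => (∑ n ∈ Finset.range N, ‖w n‖ ^ 2) / N) atTop
      (𝓝 (((L : ℝ)⁻¹) ^ 2 * ∑ a ∈ Finset.range L, ∑ b ∈ Finset.range L,
        (inner ℂ (U^[a] g) (U^[b] g)).re * c ((a : ℤ) - b))) := by
    simp_rw [hw, sum_sq_norm_block U g η L]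
    exact (tendsto_finsetSum _ fun a _ => tendsto_finsetSum _ fun b _ =>
      (hη a b).const_mul _).const_mul _
  have hbound : ((L : ℝ)⁻¹) ^ 2 * ∑ a ∈ Finset.range L, ∑ b ∈ Finset.range L,
      (inner ℂ (U^[a] g) (U^[b] g)).re * c ((a : ℤ) - b) ≤ ‖g‖ ^ 2 * S / L := by
    have h1 : ∀ a ∈ Finset.range L, ∑ b ∈ Finset.range L,
        (inner ℂ (U^[a] g) (U^[b] g)).re * c ((a : ℤ) - b) ≤ ‖g‖ ^ 2 * S := by
      intro a _
      calc _ ≤ ∑ b ∈ Finset.range L, ‖g‖ ^ 2 * |c ((a : ℤ) - b)| := by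
            refine Finset.sum_le_sum fun b _ => ?_
            refine (le_abs_self _).trans ?_
            rw [abs_mul]
            gcongr
            refine (Complex.abs_re_le_norm _).trans ((norm_inner_le_norm _ _).trans_eq ?_)
            rw [U.norm_iterate, U.norm_iterate, sq]
        _ = ‖g‖ ^ 2 * ∑ d ∈ (Finset.range L).image (fun b : ℕ => (a : ℤ) - b), |c d| := by
            rw [Finset.mul_sum, Finset.sum_image]
            intro x _ y _ hxy
            simpa using hxy
        _ ≤ _ := by
            gcongr
            exact hc.abs.sum_le_tsum _ fun d _ => abs_nonneg _
    calc _ ≤ ((L : ℝ)⁻¹) ^ 2 * ∑ a ∈ Finset.range L, ‖g‖ ^ 2 * S := by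
          gcongr with a ha
          exact h1 a ha
      _ = _ := by
          rw [Finset.sum_const, Finset.card_range, nsmul_eq_mul]
          field_simp
  -- Replacing each term by its forward block average changes only boundary terms, at cost `O(L /
  -- N)`; Cauchy–Schwarz bounds the rest by the mean square.
  have hdiff : ∀ N : ℕ, ‖(N : ℝ)⁻¹ • ∑ n ∈ Finset.range N, η n • U^[n] g‖ ≤
      2 * L * ‖g‖ * (N : ℝ)⁻¹ + √((∑ n ∈ Finset.range N, ‖w n‖ ^ 2) / N) := by
    intro N
    have h1 : ‖∑ n ∈ Finset.range N, η n • U^[n] g - ∑ n ∈ Finset.range N, w n‖ ≤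
        2 * L * ‖g‖ := by
      have e1 : ∑ n ∈ Finset.range N, η n • U^[n] g = (L : ℝ)⁻¹ • ∑ l ∈ Finset.range L,
          ∑ n ∈ Finset.range N, η n • U^[n] g := by
        rw [Finset.sum_const, Finset.card_range, ← Nat.cast_smul_eq_nsmul ℝ, smul_smul,
          inv_mul_cancel₀ hL0.ne', one_smul]
      rw [e1, hw, ← Finset.smul_sum, Finset.sum_comm (s := Finset.range N), ← smul_sub,
        ← Finset.sum_sub_distrib, norm_smul, norm_inv, Real.norm_natCast, inv_mul_le_iff₀ hL0]
      refine (norm_sum_le_of_le (n := fun _ => 2 * L * ‖g‖) _ fun l hl => ?_).trans (by simp)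
      refine (norm_sum_range_add_sub_le hu N l).trans ?_
      have : (l : ℝ) ≤ L := by exact_mod_cast (Finset.mem_range.1 hl).le
      gcongr
    have h2 : ‖(N : ℝ)⁻¹ • ∑ n ∈ Finset.range N, w n‖ ≤
        √((∑ n ∈ Finset.range N, ‖w n‖ ^ 2) / N) := Real.le_sqrt_of_sq_le (sq_norm_average_le w N)
    have h3 : (N : ℝ)⁻¹ • ∑ n ∈ Finset.range N, η n • U^[n] g =
        (N : ℝ)⁻¹ • (∑ n ∈ Finset.range N, η n • U^[n] g - ∑ n ∈ Finset.range N, w n) +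
          (N : ℝ)⁻¹ • ∑ n ∈ Finset.range N, w n := by rw [← smul_add, sub_add_cancel]
    rw [h3]
    refine (norm_add_le _ _).trans (add_le_add ?_ h2)
    rw [norm_smul, norm_inv, Real.norm_natCast, mul_comm]
    gcongr
  have hev : Tendsto (fun N : ℕ => 2 * L * ‖g‖ * (N : ℝ)⁻¹ +
      √((∑ n ∈ Finset.range N, ‖w n‖ ^ 2) / N)) atTop _ :=
    (tendsto_inv_atTop_nhds_zero_nat (𝕜 := ℝ)).const_mul _ |>.add hlim.sqrt
  rw [mul_zero, zero_add] at hev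
  have hlt := hev.eventually_lt_const ((Real.sqrt_lt' hε).2 (hbound.trans_lt hLε))
  obtain ⟨N₀, hN₀⟩ := eventually_atTop.1 hlt
  refine ⟨N₀, fun N hN => ?_⟩
  rw [Real.dist_0_eq_abs, abs_norm]
  exact (hdiff N).trans_lt (hN₀ N hN.le)

open scoped Classical in
/-- A set of natural numbers of positive density whose centred indicator has summable
autocorrelations. -/
def HasSummableCorrelations (Λ : Set ℕ) : Prop :=
  ∃ σ : ℝ, 0 < σ ∧ σ ≤ 1 ∧ ∃ c : ℤ → ℝ, Summable c ∧
    Tendsto (fun N : ℕ => (∑ n ∈ Finset.range N, if n ∈ Λ then (1 : ℝ) else 0) / N) atTop (𝓝 σ) ∧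
    ∀ a b : ℕ, Tendsto (fun N : ℕ => (∑ n ∈ Finset.range N,
      ((if n + a ∈ Λ then (1 : ℝ) else 0) - σ) * ((if n + b ∈ Λ then (1 : ℝ) else 0) - σ)) / N)
      atTop (𝓝 (c ((a : ℤ) - b)))

open scoped Classical in
theorem HasSummableCorrelations.infinite {Λ : Set ℕ} (h : HasSummableCorrelations Λ) :
    Λ.Infinite := by
  obtain ⟨σ, hσ, -, -, -, h1, -⟩ := h
  intro hfin
  have h0 : Tendsto (fun N : ℕ => (∑ n ∈ Finset.range N, if n ∈ Λ then (1 : ℝ) else 0) / N)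
      atTop (𝓝 0) := by
    refine squeeze_zero (fun N => by positivity) (fun N => ?_)
      (tendsto_const_div_atTop_nhds_zero_nat (hfin.toFinset.card : ℝ))
    gcongr
    rw [Finset.sum_boole]
    exact_mod_cast Finset.card_le_card fun n hn => by simpa using (Finset.mem_filter.1 hn).2
  exact hσ.ne' (tendsto_nhds_unique h1 h0)

open scoped Classical in
/-- The mean ergodic theorem along a set with summable correlations. -/
theorem HasSummableCorrelations.tendsto_average [CompleteSpace H] {Λ : Set ℕ}
    (h : HasSummableCorrelations Λ) (U : H →ₗᵢ[ℂ] H) (g : H) :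
    Tendsto (fun N : ℕ => ((Finset.card {n ∈ Finset.range N | n ∈ Λ} : ℂ))⁻¹ •
      ∑ n ∈ Finset.range N with n ∈ Λ, U^[n] g) atTop
      (𝓝 ((U.toContinuousLinearMap.eqLocus
        (1 : H →L[ℂ] H)).orthogonalProjectionOnto g : H)) := by
  obtain ⟨σ, hσ, hσ1, c, hc, h1, h2⟩ := h
  set Q : H := ((U.toContinuousLinearMap.eqLocus
    (1 : H →L[ℂ] H)).orthogonalProjectionOnto g : H)
  -- The indicator is split as its centred part, which averages to zero, plus the constant `σ`,
  -- which leaves `σ` times a Birkhoff average.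
  have hη := tendsto_weighted_average_zero U g
    (η := fun n => (if n ∈ Λ then (1 : ℝ) else 0) - σ) (fun n => by
      rw [abs_le]; split_ifs <;> constructor <;> linarith) hc h2
  have hB := U.toContinuousLinearMap.tendsto_birkhoffAverage_orthogonalProjection
    U.norm_toContinuousLinearMap_le g
  have hsum := hη.add (hB.const_smul σ)
  rw [zero_add] at hsum
  have hinv := (h1.inv₀ hσ.ne').smul hsum
  rw [smul_smul, inv_mul_cancel₀ hσ.ne', one_smul] at hinv
  refine hinv.congr' ?_
  filter_upwards [eventually_ne_atTop 0] with N hN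
  have hN' : (N : ℝ) ≠ 0 := by exact_mod_cast hN
  have e1 : ∑ n ∈ Finset.range N, ((if n ∈ Λ then (1 : ℝ) else 0) - σ) • U^[n] g =
      ∑ n ∈ Finset.range N with n ∈ Λ, U^[n] g - σ • ∑ n ∈ Finset.range N, U^[n] g := by
    simp_rw [sub_smul, Finset.sum_sub_distrib, ← Finset.smul_sum, ite_smul, one_smul, zero_smul,
      Finset.sum_filter]
  have e2 : birkhoffAverage ℂ U.toContinuousLinearMap _root_.id N g =
      (N : ℝ)⁻¹ • ∑ n ∈ Finset.range N, U^[n] g := by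
    rw [birkhoffAverage, birkhoffSum, ← Complex.coe_smul]
    simp
  rw [e1, e2, Finset.sum_boole, smul_sub, smul_comm σ, sub_add_cancel, smul_smul, inv_div,
    div_mul_eq_mul_div, mul_inv_cancel₀ hN', one_div, ← Complex.coe_smul]
  simp

end Hilbert

/-! ### The Koopman isometry: fixed projection as conditional expectation. -/

theorem limsup_iterate_comp {X : Type*} (φ : X → ℝ) (T : X → X) :
    (fun x => limsup (fun n : ℕ => φ (T^[n] x)) atTop) ∘ T =
      fun x => limsup (fun n : ℕ => φ (T^[n] x)) atTop := by
  ext x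
  have h : (fun n : ℕ => φ (T^[n] (T x))) = (fun n : ℕ => φ (T^[n] x)) ∘ (· + 1) := by
    ext n
    simp [Function.iterate_succ_apply]
  simp only [Function.comp_apply, h]
  rw [limsup_comp, map_add_atTop_eq_nat]

section Koopman

variable {X : Type u} [MeasurableSpace X] {ν : Measure X} {T : X → X}

/-- An almost everywhere invariant function agrees almost everywhere with a strictly invariant
one. -/
theorem MeasureTheory.MeasurePreserving.exists_measurable_invariants (hT : MeasurePreserving T ν ν)
    {φ : X → ℝ} (hφ : Measurable φ) (h : φ ∘ T =ᵐ[ν] φ) :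
    ∃ ψ : X → ℝ, Measurable[MeasurableSpace.invariants T] ψ ∧ φ =ᵐ[ν] ψ := by
  -- The upper limit along the orbit is unchanged by a shift, hence invariant everywhere; it equals
  -- `φ` wherever `φ` is constant on the orbit.
  refine ⟨fun x => limsup (fun n : ℕ => φ (T^[n] x)) atTop,
    MeasurableSpace.measurable_invariants_dom.2
      ⟨Measurable.limsup fun n => hφ.comp (hT.measurable.iterate n), fun s _ => by
        rw [limsup_iterate_comp]⟩, ?_⟩
  have hall : ∀ᵐ x ∂ν, ∀ n : ℕ, φ (T (T^[n] x)) = φ (T^[n] x) :=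
    ae_all_iff.2 fun n => (hT.iterate n).quasiMeasurePreserving.ae h
  filter_upwards [hall] with x hx
  have hc : ∀ n : ℕ, φ (T^[n] x) = φ x := fun n => by
    induction n with
    | zero => rfl
    | succ n ih => rw [Function.iterate_succ_apply', hx, ih]
  simp [hc]

theorem MeasureTheory.MeasurePreserving.aestronglyMeasurable_invariants
    (hT : MeasurePreserving T ν ν) {φ : X → ℂ} (hφ : Measurable φ) (h : φ ∘ T =ᵐ[ν] φ) :
    AEStronglyMeasurable[MeasurableSpace.invariants T] φ ν := by
  obtain ⟨a, ha, hφa⟩ := hT.exists_measurable_invariants (Complex.measurable_re.comp hφ)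
    (h.mono fun x hx => congrArg Complex.re hx)
  obtain ⟨b, hb, hφb⟩ := hT.exists_measurable_invariants (Complex.measurable_im.comp hφ)
    (h.mono fun x hx => congrArg Complex.im hx)
  refine ⟨fun x => (a x : ℂ) + (b x : ℂ) * Complex.I,
    ((Complex.measurable_ofReal.comp ha).add
      ((Complex.measurable_ofReal.comp hb).mul_const _)).stronglyMeasurable, ?_⟩
  filter_upwards [hφa, hφb] with x hxa hxb
  rw [← hxa, ← hxb]
  exact (Complex.re_add_im _).symm

/-- The Koopman isometry of a measure-preserving map. -/
noncomputable abbrev koopman (hT : MeasurePreserving T ν ν) : Lp ℂ 2 ν →ₗᵢ[ℂ] Lp ℂ 2 ν :=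
  Lp.compMeasurePreservingₗᵢ ℂ T hT

/-- The orthogonal projection of a vector on the fixed space of an isometry. -/
noncomputable abbrev fixedProj {H : Type*} [NormedAddCommGroup H] [InnerProductSpace ℂ H]
    [CompleteSpace H] (U : H →ₗᵢ[ℂ] H) (g : H) :
    U.toContinuousLinearMap.eqLocus (1 : H →L[ℂ] H) :=
  (U.toContinuousLinearMap.eqLocus (1 : H →L[ℂ] H)).orthogonalProjectionOnto g

theorem koopman_iterate_toLp (hT : MeasurePreserving T ν ν) {g : X → ℂ} (hg : MemLp g 2 ν) (n : ℕ) :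
    (koopman hT)^[n] hg.toLp = (hg.comp_measurePreserving (hT.iterate n)).toLp _ := by
  have := congrFun (Lp.compMeasurePreserving_iterate (E := ℂ) (p := 2) hT n) hg.toLp
  rw [Lp.toLp_compMeasurePreserving] at this
  exact this

theorem inner_fixedProj_of_fixed {H : Type*} [NormedAddCommGroup H] [InnerProductSpace ℂ H]
    [CompleteSpace H] (U : H →ₗᵢ[ℂ] H) (g : H) {e : H} (he : U e = e) :
    inner ℂ e (fixedProj U g : H) = inner ℂ e g :=
  (U.toContinuousLinearMap.eqLocus (1 : H →L[ℂ] H)).inner_orthogonalProjectionOnto_eq_of_mem_left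
    ⟨e, he⟩ g

/-- Indicators of invariant sets are fixed vectors, so pairing with them gives the required set
integrals. The projection is itself fixed, hence almost everywhere invariant, which gives
measurability. -/
theorem fixedProj_ae_eq_condExp [IsProbabilityMeasure ν] (hT : MeasurePreserving T ν ν) {g : X → ℂ}
    (hg : MemLp g 2 ν) :
    (fixedProj (koopman hT) hg.toLp : Lp ℂ 2 ν) =ᵐ[ν] ν[g | MeasurableSpace.invariants T] := by
  set Q := fixedProj (koopman hT) hg.toLp with hQ
  have hQi : Integrable (Q : Lp ℂ 2 ν) ν := (Lp.memLp (Q : Lp ℂ 2 ν)).integrable one_le_two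
  refine ae_eq_condExp_of_forall_setIntegral_eq (MeasurableSpace.invariants_le T)
    (hg.integrable one_le_two) (fun s _ _ => hQi.integrableOn) (fun s hs hνs => ?_) ?_
  · obtain ⟨hs1, hs2⟩ := MeasurableSpace.measurableSet_invariants.1 hs
    have he : koopman hT (indicatorConstLp 2 hs1 hνs.ne (1 : ℂ)) =
        indicatorConstLp 2 hs1 hνs.ne (1 : ℂ) := by
      refine (Lp.indicatorConstLp_compMeasurePreserving hs1 hνs.ne (1 : ℂ) hT).trans ?_
      congr 1
    have h1 := inner_fixedProj_of_fixed (koopman hT) hg.toLp he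
    rw [L2.inner_indicatorConstLp_one, L2.inner_indicatorConstLp_one] at h1
    rw [hQ, h1]
    exact integral_congr_ae (ae_restrict_of_ae hg.coeFn_toLp)
  · refine hT.aestronglyMeasurable_invariants (Lp.stronglyMeasurable _).measurable ?_
    have h1 : koopman hT (Q : Lp ℂ 2 ν) = Q := Q.2
    have h2 := Lp.coeFn_compMeasurePreserving (Q : Lp ℂ 2 ν) hT
    refine h2.symm.trans ?_
    rw [show Lp.compMeasurePreserving T hT (Q : Lp ℂ 2 ν) = Q from h1]

end Koopman

/-! ### From counting averages to the increasing enumeration. -/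

section Enumeration

open scoped Classical in
theorem sum_filter_range_nth {M : Type*} [AddCommMonoid M] {Λ : Set ℕ} (hΛ : Λ.Infinite) (a : ℕ → M)
    (N : ℕ) :
    ∑ n ∈ Finset.range (Nat.nth (· ∈ Λ) N) with n ∈ Λ, a n =
      ∑ k ∈ Finset.range N, a (Nat.nth (· ∈ Λ) k) := by
  induction N with
  | zero =>
    rw [Finset.range_zero, Finset.sum_empty, Finset.filter_eq_empty_iff.2, Finset.sum_empty]
    intro n hn hnΛ
    have := Nat.nth_zero (p := (· ∈ Λ)) ▸ Finset.mem_range.1 hn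
    exact this.not_ge (Nat.sInf_le hnΛ)
  | succ N ih =>
    rw [Nat.filter_range_nth_eq_insert_of_infinite (p := (· ∈ Λ)) hΛ, Finset.sum_insert (by simp), ih,
      Finset.sum_range_succ, add_comm]

open scoped Classical in
/-- The mean ergodic theorem along the increasing enumeration of a set with summable
correlations. -/
theorem HasSummableCorrelations.tendsto_average_nth {H : Type*} [NormedAddCommGroup H]
    [InnerProductSpace ℂ H] [CompleteSpace H] {Λ : Set ℕ} (h : HasSummableCorrelations Λ)
    (U : H →ₗᵢ[ℂ] H) (g : H) :
    Tendsto (fun N : ℕ => (N : ℂ)⁻¹ • ∑ k ∈ Finset.range N, U^[Nat.nth (· ∈ Λ) k] g) atTop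
      (𝓝 (fixedProj U g : H)) := by
  -- Sampling at cutoff `u_N` captures exactly `u_0, …, u_{N-1}`, since the cutoff itself is
  -- excluded.
  have h1 := (h.tendsto_average U g).comp (Nat.nth_strictMono (p := (· ∈ Λ)) h.infinite).tendsto_atTop
  refine h1.congr fun N => ?_
  simp only [Function.comp_apply]
  rw [sum_filter_range_nth h.infinite, ← Nat.count_eq_card_filter_range,
    Nat.count_nth_of_infinite (p := (· ∈ Λ)) h.infinite]

end Enumeration

/-! ### Exactness, Wiener averages and recurrence. -/

theorem HasSummableCorrelations.isL2Exact {Λ : Set ℕ} (h : HasSummableCorrelations Λ) :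
    IsL2Exact.{u} Λ := by
  refine ⟨h.infinite, fun X _ ν _ T hT g hg => ?_⟩
  have h1 := (Lp.tendsto_Lp_iff_tendsto_eLpNorm' _ _).1
    (h.tendsto_average_nth (koopman hT) hg.toLp)
  refine h1.congr fun N => eLpNorm_congr_ae ?_
  refine EventuallyEq.sub ?_ (fixedProj_ae_eq_condExp hT hg)
  refine (Lp.coeFn_smul _ _).trans ?_
  have h2 : ∀ᵐ x ∂ν, ∀ k : ℕ, ((koopman hT)^[k] hg.toLp) x = g (T^[k] x) := by
    refine ae_all_iff.2 fun k => ?_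
    rw [koopman_iterate_toLp]
    exact MemLp.coeFn_toLp _
  filter_upwards [Lp.coeFn_finsetSum (Finset.range N)
    fun k => (koopman hT)^[Nat.nth (· ∈ Λ) k] hg.toLp, h2] with x hx hx2
  rw [Pi.smul_apply, hx, Finset.sum_apply]
  simp [averageAlong, hx2]

/-- The mean ergodic theorem is applied to multiplication by `z = e^{2πit}` on `ℂ`; as `z ≠ 1`, its
fixed space is zero. -/
theorem HasSummableCorrelations.tendsto_wienerAverage {Λ : Set ℕ} (h : HasSummableCorrelations Λ)
    {t : ℝ} (ht : t ∈ Set.Ioo (0 : ℝ) 1) :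
    Tendsto (fun N : ℕ => wienerAverage Λ N t) atTop (𝓝 0) := by
  set z : ℂ := Complex.exp (2 * Real.pi * Complex.I * t) with hz
  have hz1 : ‖z‖ = 1 := by
    rw [hz, show (2 * Real.pi * Complex.I * t : ℂ) = ((2 * Real.pi * t : ℝ) : ℂ) * Complex.I by
      push_cast; ring]
    exact Complex.norm_exp_ofReal_mul_I _
  have hzne : z ≠ 1 := by
    intro h1
    obtain ⟨n, hn⟩ := Complex.exp_eq_one_iff.1 h1
    have h2 : (t : ℂ) = n := by
      have : (2 * Real.pi * Complex.I : ℂ) ≠ 0 := Complex.two_pi_I_ne_zero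
      exact mul_left_cancel₀ this (by rw [hn]; ring)
    have h3 : t = n := by exact_mod_cast h2
    have h4 := ht.1
    have h5 := ht.2
    rw [h3] at h4 h5
    norm_cast at h4 h5
    omega
  let U : ℂ →ₗᵢ[ℂ] ℂ := ⟨LinearMap.mulLeft ℂ z, fun x => by simp [hz1]⟩
  have hU : ∀ x, U x = z * x := fun x => rfl
  have hiter : ∀ n : ℕ, U^[n] 1 = z ^ n := fun n => by
    induction n with
    | zero => rfl
    | succ n ih => rw [Function.iterate_succ_apply', ih, hU, pow_succ']
  have hQ : (fixedProj U 1 : ℂ) = 0 := by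
    have h1 : z * (fixedProj U 1 : ℂ) = fixedProj U 1 := (fixedProj U 1).2
    by_contra h0
    exact hzne (mul_right_cancel₀ h0 (h1.trans (one_mul _).symm))
  have h1 := h.tendsto_average U 1
  rw [hQ] at h1
  refine h1.congr fun N => ?_
  rw [wienerAverage, smul_eq_mul, ← div_eq_inv_mul]
  congr 1
  refine Finset.sum_congr rfl fun n _ => ?_
  rw [hiter, hz, ← Complex.exp_nat_mul]
  congr 1
  ring

/-- If no positive return time worked, the averages of `ν (A ∩ T⁻ⁿ A)` along `Λ` would vanish in the
limit. Their limit is `‖Q‖²`, with `Q` the fixed projection of the indicator of `A`. But `Q = 0`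
contradicts `⟨1, Q⟩ = ν A > 0`. -/
theorem HasSummableCorrelations.isRecurrent {Λ : Set ℕ} (h : HasSummableCorrelations Λ) :
    IsRecurrent.{u} Λ := by
  intro X _ ν _ T hT A hA hνA
  by_contra! hcon
  set e : Lp ℂ 2 ν := indicatorConstLp 2 hA (measure_ne_top ν A) (1 : ℂ) with he
  set Q := fixedProj (koopman hT) e with hQ
  have hiter : ∀ n : ℕ, inner ℂ e ((koopman hT)^[n] e) = (ν.real (A ∩ T^[n] ⁻¹' A) : ℂ) := by
    intro n
    have h1 : (koopman hT)^[n] e = indicatorConstLp 2 ((hT.iterate n).measurable hA)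
        (measure_ne_top ν _) (1 : ℂ) :=
      congrFun (Lp.compMeasurePreserving_iterate (E := ℂ) (p := 2) hT n) e
    rw [h1, he, L2.inner_indicatorConstLp_one_indicatorConstLp_one]
    rfl
  have hlim : Tendsto (fun N : ℕ => inner ℂ e ((N : ℂ)⁻¹ • ∑ k ∈ Finset.range N,
      (koopman hT)^[Nat.nth (· ∈ Λ) k] e)) atTop (𝓝 (inner ℂ e (Q : Lp ℂ 2 ν))) :=
    tendsto_const_nhds.inner (h.tendsto_average_nth (koopman hT) e)
  have hzero : Tendsto (fun N : ℕ => inner ℂ e ((N : ℂ)⁻¹ • ∑ k ∈ Finset.range N,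
      (koopman hT)^[Nat.nth (· ∈ Λ) k] e)) atTop (𝓝 0) := by
    refine squeeze_zero_norm (fun N => ?_) (tendsto_inv_atTop_nhds_zero_nat (𝕜 := ℝ))
    rw [inner_smul_right, inner_sum, norm_mul, norm_inv, Complex.norm_natCast]
    refine mul_le_of_le_one_right (by positivity) ?_
    -- Only `k = 0` can contribute, because `u_0` may be `0`; the factor `1 / N` kills that single
    -- term.
    refine (norm_sum_le_of_le (n := fun k => if k = 0 then (1 : ℝ) else 0) _
      fun k _ => ?_).trans ?_
    · rw [hiter, Complex.norm_real, Real.norm_of_nonneg measureReal_nonneg]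
      split_ifs with hk
      · exact measureReal_le_one
      · have hpos : 0 < Nat.nth (· ∈ Λ) k :=
          (Nat.zero_le _).trans_lt (Nat.nth_strictMono (p := (· ∈ Λ)) h.infinite (Nat.pos_of_ne_zero hk))
        have := hcon _ (Nat.nth_mem_of_infinite (p := (· ∈ Λ)) h.infinite k) hpos
        rw [Measure.real, nonpos_iff_eq_zero.1 this, ENNReal.toReal_zero]
    · rw [Finset.sum_ite_eq']
      split_ifs <;> norm_num
  have h0 : inner ℂ e (Q : Lp ℂ 2 ν) = 0 := tendsto_nhds_unique hlim hzero
  have hQfix : koopman hT (Q : Lp ℂ 2 ν) = Q := Q.2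
  have hQ0 : (Q : Lp ℂ 2 ν) = 0 := by
    rw [← inner_self_eq_zero (𝕜 := ℂ)]
    refine (inner_fixedProj_of_fixed (koopman hT) e hQfix).trans ?_
    rw [← inner_conj_symm, h0, map_zero]
  have hone : koopman hT (indicatorConstLp 2 MeasurableSet.univ (measure_ne_top ν _) (1 : ℂ)) =
      indicatorConstLp 2 MeasurableSet.univ (measure_ne_top ν _) (1 : ℂ) :=
    Lp.indicatorConstLp_compMeasurePreserving MeasurableSet.univ (measure_ne_top ν _) (1 : ℂ) hT
  have h2 := inner_fixedProj_of_fixed (koopman hT) e hone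
  rw [← hQ, hQ0, inner_zero_right, he, L2.inner_indicatorConstLp_one_indicatorConstLp_one,
    Set.univ_inter] at h2
  have h3 : ν.real A = 0 := Complex.ofReal_eq_zero.1 h2.symm
  exact (ENNReal.toReal_pos hνA.ne' (measure_ne_top ν A)).ne' h3

/-! ### Almost every sample has summable correlations. -/

theorem ae_hasSummableCorrelations_natPart {f : UnitAddCircle → ℝ} (hf_meas : Measurable f)
    (hf : ∀ t, f t ∈ Set.Icc (0 : ℝ) 1)
    (hσ_pos : 0 < ∫ t, f t ∂(AddCircle.haarAddCircle : Measure UnitAddCircle))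
    (hσ_le : ∫ t, f t ∂(AddCircle.haarAddCircle : Measure UnitAddCircle) ≤ 1)
    {Ω : Type v} [MeasurableSpace Ω] {P : Measure Ω} [IsProbabilityMeasure P]
    {𝔛 : Ω → Set ℤ} (h : IsDeterminantalProcess P (toeplitzKernel f) 𝔛) :
    ∀ᵐ ω ∂P, HasSummableCorrelations (natPart (𝔛 ω)) := by
  classical
  set σ := ∫ t, f t ∂(AddCircle.haarAddCircle : Measure UnitAddCircle) with hσ
  have h1 : ∀ᵐ ω ∂P, ∀ a : ℕ, Tendsto
      (fun N : ℕ => (∑ n ∈ Finset.range N, occupation 𝔛 (n + (a : ℤ)) ω) / N) atTop (𝓝 σ) :=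
    ae_all_iff.2 fun a => ae_tendsto_average_occupation hf_meas hf h a
  have h2 : ∀ᵐ ω ∂P, ∀ a b : ℕ, a ≠ b → Tendsto (fun N : ℕ => (∑ n ∈ Finset.range N,
      occupation 𝔛 (n + (a : ℤ)) ω * occupation 𝔛 (n + (b : ℤ)) ω) / N) atTop
      (𝓝 (σ ^ 2 - ‖fourierCoeff (fun t => (f t : ℂ)) ((a : ℤ) - b)‖ ^ 2)) := by
    refine ae_all_iff.2 fun a => ae_all_iff.2 fun b => ?_
    by_cases hab : a = b
    · exact ae_of_all _ fun ω hne => absurd hab hne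
    · filter_upwards [ae_tendsto_average_occupation_mul hf_meas hf h
        (show (a : ℤ) ≠ b by exact_mod_cast hab)] with ω hω _
      exact hω
  filter_upwards [h1, h2] with ω hω1 hω2
  have hocc : ∀ n a : ℕ, (if n + a ∈ natPart (𝔛 ω) then (1 : ℝ) else 0) =
      occupation 𝔛 (n + (a : ℤ)) ω := fun n a => by
    simp [occupation, natPart]
  -- At `d = 0` this is `σ - σ²`, the variance of an indicator, because `f̂ 0 = σ`; elsewhere it is
  -- the covariance `-|f̂ d|²`.
  set c : ℤ → ℝ := fun d => (Pi.single 0 σ : ℤ → ℝ) d -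
    ‖fourierCoeff (fun t => (f t : ℂ)) d‖ ^ 2 with hcdef
  have hc : Summable c :=
    (show Summable fun d => (Pi.single 0 σ : ℤ → ℝ) d from (hasSum_pi_single 0 σ).summable).sub
      (summable_sq_norm_fourierCoeff hf_meas hf)
  refine ⟨σ, hσ_pos, hσ_le, c, hc, ?_, fun a b => ?_⟩
  · refine (hω1 0).congr fun N => ?_
    exact congrArg (· / (N : ℝ)) (Finset.sum_congr rfl fun n _ => (hocc n 0).symm)
  simp_rw [hocc]
  have hmul : Tendsto (fun N : ℕ => (∑ n ∈ Finset.range N,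
      occupation 𝔛 (n + (a : ℤ)) ω * occupation 𝔛 (n + (b : ℤ)) ω) / N) atTop
      (𝓝 (σ ^ 2 + c ((a : ℤ) - b))) := by
    rcases eq_or_ne a b with rfl | hab
    · simp_rw [occupation_mul_self]
      have : σ ^ 2 + c ((a : ℤ) - a) = σ := by
        simp only [hcdef, sub_self, Pi.single_eq_same, fourierCoeff_ofReal_zero, Complex.norm_real,
          Real.norm_eq_abs, sq_abs]
        ring
      rw [this]
      exact hω1 a
    · have h0 : (a : ℤ) - b ≠ 0 := sub_ne_zero.2 (by exact_mod_cast hab)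
      have := hω2 a b hab
      simpa only [hcdef, Pi.single_eq_of_ne h0, zero_sub, ← sub_eq_add_neg] using this
  have hfin := ((hmul.sub ((hω1 a).const_mul σ)).sub ((hω1 b).const_mul σ)).add_const (σ ^ 2)
  rw [show σ ^ 2 + c ((a : ℤ) - b) - σ * σ - σ * σ + σ ^ 2 = c ((a : ℤ) - b) by ring] at hfin
  refine hfin.congr' ?_
  filter_upwards [eventually_ne_atTop 0] with N hN
  have hN' : (N : ℝ) ≠ 0 := by exact_mod_cast hN
  have e1 : ∀ n : ℕ, (occupation 𝔛 (n + (a : ℤ)) ω - σ) * (occupation 𝔛 (n + (b : ℤ)) ω - σ) =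
      occupation 𝔛 (n + (a : ℤ)) ω * occupation 𝔛 (n + (b : ℤ)) ω -
        σ * occupation 𝔛 (n + (a : ℤ)) ω - σ * occupation 𝔛 (n + (b : ℤ)) ω + σ ^ 2 := by
    intro n; ring
  simp_rw [e1]
  rw [Finset.sum_add_distrib, Finset.sum_sub_distrib, Finset.sum_sub_distrib, ← Finset.mul_sum,
    ← Finset.mul_sum, Finset.sum_const, Finset.card_range, nsmul_eq_mul]
  field_simp

theorem theorem2p1 (f : UnitAddCircle → ℝ) (hf_meas : Measurable f)
    (hf : ∀ t, f t ∈ Set.Icc (0 : ℝ) 1)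
    (hσ_pos : 0 < ∫ t, f t ∂(AddCircle.haarAddCircle : Measure UnitAddCircle))
    (hσ_lt : ∫ t, f t ∂(AddCircle.haarAddCircle : Measure UnitAddCircle) < 1)
    {Ω : Type v} [MeasurableSpace Ω] (P : Measure Ω) [IsProbabilityMeasure P]
    (𝔛 : Ω → Set ℤ) (h𝔛 : IsDeterminantalProcess P (toeplitzKernel f) 𝔛) :
    ∀ᵐ ω ∂P,
      IsL2Exact.{u} (natPart (𝔛 ω)) ∧
      (∀ t : ℝ, t ∈ Set.Ioo (0 : ℝ) 1 →
        Tendsto (fun N : ℕ => wienerAverage (natPart (𝔛 ω)) N t) atTop (𝓝 0)) ∧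
      IsRecurrent.{u} (natPart (𝔛 ω)) := by
  filter_upwards [ae_hasSummableCorrelations_natPart hf_meas hf hσ_pos hσ_lt.le h𝔛] with ω hω
  exact ⟨hω.isL2Exact, fun t ht => hω.tendsto_wienerAverage ht, hω.isRecurrent⟩
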